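/- For integers $k\ge 1$ let $H_k^{(2)}=\sum_{j=1}^{k}\frac{1}{j^2}$, and let $\zeta$ denote the Riemann zeta function. Then the following three series converge and have the stated sums: $$\sum_{n=1}^{\infty}\frac{1}{2^{n+1}}\sum_{k=1}^{n}\binom{n}{k}\frac{H_k^{(2)}}{k^4}=\zeta(2)\zeta(4)+\zeta(3)^2-\frac{25}{12}\zeta(6),$$ $$\sum_{n=1}^{\infty}\frac{1}{2^{n+1}}\sum_{k=1}^{n}\binom{n}{k}\frac{H_k^{(2)}}{k^2}=\zeta(2)^2-\frac{3}{4}\zeta(4),$$ $$\sum_{n=1}^{\infty}\frac{1}{2^{n+1}}\sum_{k=1}^{n}\binom{n}{k}\frac{H_k^{(2)}}{k^3}=3\zeta(2)\zeta(3)-\frac{9}{2}\zeta(5).$$ -/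

import Mathlib

/-- The generalized harmonic number `H_n^{(r)} = ∑_{j=1}^n 1 / j^r`. -/
noncomputable def genHarmonic (r n : ℕ) : ℝ :=
  ∑ j ∈ Finset.Icc 1 n, 1 / (j : ℝ) ^ r

/-- The summand of index `n`, namely `2^{-(n+1)} ∑_{k=1}^n C(n,k) H_k^{(2)} / k^q`.
It vanishes at `n = 0`, the inner sum being empty, so that summing it over all of `ℕ` is the
same as summing it over `n ≥ 1`. -/
noncomputable def binomHarmonicTerm (q n : ℕ) : ℝ :=
  1 / 2 ^ (n + 1) * ∑ k ∈ Finset.Icc 1 n, (n.choose k : ℝ) * (genHarmonic 2 k / (k : ℝ) ^ q)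

/-! For each k the weights C(n,k)/2^(n+1) sum to 1 over n, so by Tonelli the series collapses to ∑
H_k^(2)/k^q = ζ(q,2) + ζ(q+2) (`hasSum_binomHarmonicTerm`). The double zeta value is then found by
linear algebra. Weight 4 needs only the stuffle product, weight 5 stuffle, shuffle and the sum
formula, and weight 6 the stuffle and shuffle forms of ζ(3)² and ζ(2)ζ(4). In even weight, Euler's
closed forms of ζ(2), ζ(4), ζ(6) bring the answer to the stated shape. -/

/-- The double zeta value `∑_{n > m ≥ 1} 1 / (n ^ a * m ^ b)`, indexed by `m - 1` and `n - m - 1`. -/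
noncomputable def doubleZeta (a b : ℕ) : ℝ :=
  ∑' p : ℕ × ℕ, 1 / (((p.1 : ℝ) + p.2 + 2) ^ a * ((p.1 : ℝ) + 1) ^ b)

/-- The zeta value `∑_{n ≥ 1} 1 / n ^ s`. -/
noncomputable def zetaReal (s : ℕ) : ℝ := ∑' n : ℕ, 1 / ((n : ℝ) + 1) ^ s

/-! ### Zeta and double zeta series: convergence and rearrangement -/

theorem hasSum_of_forall_eq {α : Type*} {f g : α → ℝ} {S : ℝ} (hf : HasSum f S)
    (h : ∀ x, f x = g x) : HasSum g S :=
  funext h ▸ hf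

theorem hasSum_zetaReal {s : ℕ} (hs : 2 ≤ s) :
    HasSum (fun n : ℕ => 1 / ((n : ℝ) + 1) ^ s) (zetaReal s) := by
  have h := (summable_nat_add_iff 1).2 (Real.summable_one_div_nat_pow.2 (show 1 < s by omega))
  push_cast at h
  exact h.hasSum

theorem riemannZeta_eq_zetaReal {s : ℕ} (hs : 2 ≤ s) : riemannZeta s = (zetaReal s : ℂ) := by
  have h := zeta_eq_tsum_one_div_nat_add_one_cpow (s := (s : ℂ))
    (by simp only [Complex.natCast_re]; exact_mod_cast hs)
  rw [h, zetaReal, Complex.ofReal_tsum]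
  refine tsum_congr fun n => ?_
  push_cast
  rw [Complex.cpow_natCast]

theorem hasSum_comm_of_nonneg {α β : Type*} {f : α → β → ℝ} (h0 : ∀ a b, 0 ≤ f a b)
    {r : α → ℝ} {c : β → ℝ} {S : ℝ} (hr : ∀ a, HasSum (f a) (r a)) (hS : HasSum r S)
    (hc : ∀ b, HasSum (fun a => f a b) (c b)) : HasSum c S := by
  have hs : Summable (fun p : α × β => f p.1 p.2) := by
    refine (summable_prod_of_nonneg (fun p => h0 p.1 p.2)).2 ⟨fun a => (hr a).summable, ?_⟩
    simpa only [(hr _).tsum_eq] using hS.summable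
  have h1 : HasSum (fun p : α × β => f p.1 p.2) S := by
    have h2 := hs.hasSum.prod_fiberwise hr
    rw [← h2.unique hS]
    exact hs.hasSum
  exact ((Equiv.prodComm β α).hasSum_iff.2 h1).prod_fiberwise hc

theorem hasSum_prod_of_nonneg {α β : Type*} {f : α × β → ℝ} (h0 : ∀ p, 0 ≤ f p)
    {r : α → ℝ} {S : ℝ} (hr : ∀ a, HasSum (fun b => f (a, b)) (r a)) (hS : HasSum r S) :
    HasSum f S := by
  have hs : Summable f := by
    refine (summable_prod_of_nonneg h0).2 ⟨fun a => (hr a).summable, ?_⟩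
    simpa only [(hr _).tsum_eq] using hS.summable
  rw [← (hs.hasSum.prod_fiberwise hr).unique hS]
  exact hs.hasSum

theorem hasSum_zetaReal_mul {a b : ℕ} (ha : 2 ≤ a) (hb : 2 ≤ b) :
    HasSum (fun p : ℕ × ℕ => 1 / (((p.1 : ℝ) + 1) ^ a * ((p.2 : ℝ) + 1) ^ b))
      (zetaReal a * zetaReal b) := by
  refine hasSum_prod_of_nonneg (r := fun n : ℕ => 1 / ((n : ℝ) + 1) ^ a * zetaReal b)
    (fun p => by positivity) (fun n => ?_) ((hasSum_zetaReal ha).mul_right _)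
  simpa only [one_div_mul_one_div] using (hasSum_zetaReal hb).mul_left (1 / ((n : ℝ) + 1) ^ a)

theorem hasSum_doubleZeta {a b : ℕ} (ha : 2 ≤ a) (hb : 1 ≤ b) (hab : 4 ≤ a + b) :
    HasSum (fun p : ℕ × ℕ => 1 / (((p.1 : ℝ) + p.2 + 2) ^ a * ((p.1 : ℝ) + 1) ^ b))
      (doubleZeta a b) := by
  refine Summable.hasSum <| Summable.of_nonneg_of_le (fun p => by positivity) (fun p => ?_)
    (hasSum_zetaReal_mul le_rfl le_rfl).summable
  have h1 : (p.1 : ℝ) + 1 ≤ p.1 + p.2 + 2 := by linarith [(p.2.cast_nonneg : (0 : ℝ) ≤ p.2)]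
  have h2 : (p.2 : ℝ) + 1 ≤ p.1 + p.2 + 2 := by linarith [(p.1.cast_nonneg : (0 : ℝ) ≤ p.1)]
  have h3 : (1 : ℝ) ≤ p.1 + 1 := by linarith [(p.1.cast_nonneg : (0 : ℝ) ≤ p.1)]
  generalize (p.1 : ℝ) + p.2 + 2 = n at *
  generalize (p.1 : ℝ) + 1 = m at *
  have h4 : (0 : ℝ) < (p.2 : ℝ) + 1 := by positivity
  generalize (p.2 : ℝ) + 1 = k at *
  refine one_div_le_one_div_of_le (by positivity) ?_
  have hn : 1 ≤ n := h3.trans h1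
  rcases Nat.lt_or_ge b 2 with hb2 | hb2
  -- Here b = 1 forces a ≥ 3, and the third power of n absorbs one factor m.
  · calc m ^ 2 * k ^ 2 = (m * k ^ 2) * m ^ 1 := by ring
      _ ≤ (n * n ^ 2) * m ^ b := by gcongr
      _ = n ^ 3 * m ^ b := by ring
      _ ≤ n ^ a * m ^ b := by gcongr; omega
  · calc m ^ 2 * k ^ 2 ≤ m ^ b * n ^ a := by
          refine mul_le_mul (pow_le_pow_right₀ h3 hb2) ?_ (by positivity) (by positivity)
          exact (pow_le_pow_left₀ h4.le h2 2).trans (pow_le_pow_right₀ hn ha)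
      _ = n ^ a * m ^ b := mul_comm _ _

theorem hasSum_doubleZeta_swap {a b : ℕ} (ha : 2 ≤ a) (hb : 1 ≤ b) (hab : 4 ≤ a + b) :
    HasSum (fun p : ℕ × ℕ => 1 / (((p.1 : ℝ) + p.2 + 2) ^ a * ((p.2 : ℝ) + 1) ^ b))
      (doubleZeta a b) := by
  have h := (Equiv.prodComm ℕ ℕ).hasSum_iff.2 (hasSum_doubleZeta ha hb hab)
  convert h using 2 with p
  simp [add_comm (p.1 : ℝ)]

/-- Summation over `m < n` as an iterated sum. -/
theorem hasSum_sum_range_doubleZeta {a b : ℕ} (ha : 2 ≤ a) (hb : 1 ≤ b) (hab : 4 ≤ a + b) :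
    HasSum (fun n : ℕ => ∑ j ∈ Finset.range n, 1 / (((n : ℝ) + 1) ^ a * ((j : ℝ) + 1) ^ b))
      (doubleZeta a b) := by
  have h := (Finset.HasAntidiagonal.sigmaAntidiagonalEquivProd.hasSum_iff.2 (hasSum_doubleZeta ha hb hab)).sigma
    (fun n => hasSum_fintype _)
  -- The term n = 0 is empty; after the shift, the antidiagonal of n carries the outer variable n +
  -- 2.
  rw [← hasSum_nat_add_iff' 1]
  simp only [Finset.range_one, Finset.sum_singleton, Finset.range_zero, Finset.sum_empty, sub_zero]
  refine hasSum_of_forall_eq h fun n => Eq.symm ?_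
  refine Eq.trans ?_ (Finset.sum_coe_sort (Finset.HasAntidiagonal.antidiagonal n)
    (fun p : ℕ × ℕ => 1 / (((p.1 : ℝ) + p.2 + 2) ^ a * ((p.1 : ℝ) + 1) ^ b))).symm
  rw [Finset.Nat.sum_antidiagonal_eq_sum_range_succ_mk]
  refine Finset.sum_congr rfl fun j hj => ?_
  have hj' : j ≤ n := Nat.lt_succ_iff.1 (Finset.mem_range.1 hj)
  push_cast [hj']
  ring_nf

theorem genHarmonic_succ (r n : ℕ) :
    genHarmonic r (n + 1) = ∑ j ∈ Finset.range (n + 1), 1 / ((j : ℝ) + 1) ^ r := by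
  rw [genHarmonic, Finset.range_eq_Ico, ← Finset.Ico_add_one_right_eq_Icc]
  simpa using (Finset.sum_Ico_add' (fun j : ℕ => 1 / (j : ℝ) ^ r) 0 (n + 1) 1).symm

theorem hasSum_genHarmonic_div {r q : ℕ} (hr : 1 ≤ r) (hq : 2 ≤ q) (hrq : 4 ≤ q + r) :
    HasSum (fun n : ℕ => genHarmonic r (n + 1) / ((n : ℝ) + 1) ^ q)
      (doubleZeta q r + zetaReal (q + r)) := by
  convert (hasSum_sum_range_doubleZeta hq hr hrq).add
    (hasSum_zetaReal (show 2 ≤ q + r by omega)) using 2 with n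
  rw [genHarmonic_succ, Finset.sum_range_succ, add_div, Finset.sum_div, pow_add]
  congr 1
  · refine Finset.sum_congr rfl fun j _ => ?_
    rw [div_div, mul_comm]
  · rw [div_div, mul_comm]

/-! ### Relations between double zeta values -/

/-- The stuffle product. -/
theorem zetaReal_mul_zetaReal {a b : ℕ} (ha : 2 ≤ a) (hb : 2 ≤ b) :
    zetaReal a * zetaReal b = doubleZeta a b + doubleZeta b a + zetaReal (a + b) := by
  -- The quadrant splits into x > y, x < y and the diagonal.
  let e : (ℕ × ℕ) ⊕ ((ℕ × ℕ) ⊕ ℕ) → ℕ × ℕ :=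
    Sum.elim (fun p => (p.1 + p.2 + 1, p.1))
      (Sum.elim (fun p => (p.1, p.1 + p.2 + 1)) (fun n => (n, n)))
  have he : Function.Bijective e := by
    constructor
    · rintro (⟨x, y⟩ | ⟨x, y⟩ | x) (⟨z, w⟩ | ⟨z, w⟩ | z) h <;>
        simp [e] at h ⊢ <;> omega
    · rintro ⟨x, y⟩
      rcases lt_trichotomy x y with h | h | h
      · exact ⟨Sum.inr (Sum.inl (x, y - x - 1)), by simp [e]; omega⟩
      · exact ⟨Sum.inr (Sum.inr x), by simp [e, h]⟩
      · exact ⟨Sum.inl (y, x - y - 1), by simp [e]; omega⟩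
  have h1 := (Equiv.ofBijective e he).hasSum_iff.2 (hasSum_zetaReal_mul ha hb)
  refine h1.unique ?_
  rw [add_assoc]
  refine HasSum.sum ?_ (HasSum.sum ?_ ?_)
  · convert hasSum_doubleZeta ha (show 1 ≤ b by omega) (by omega) using 2 with p
    simp only [e, Function.comp_apply, Equiv.ofBijective_apply, Sum.elim_inl]
    push_cast
    ring_nf
  · convert hasSum_doubleZeta hb (show 1 ≤ a by omega) (by omega) using 2 with p
    simp only [e, Function.comp_apply, Equiv.ofBijective_apply, Sum.elim_inl, Sum.elim_inr]
    push_cast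
    ring_nf
  · convert hasSum_zetaReal (show 2 ≤ a + b by omega) using 2 with p
    simp only [e, Function.comp_apply, Equiv.ofBijective_apply, Sum.elim_inr, pow_add]

/-- Telescoping: `∑_{k ≥ 1} (1 / k - 1 / (k + m)) = H_m`. -/
theorem hasSum_one_div_sub_one_div (m : ℕ) :
    HasSum (fun k : ℕ => 1 / ((k : ℝ) + 1) - 1 / ((k : ℝ) + 1 + m))
      (∑ j ∈ Finset.range m, 1 / ((j : ℝ) + 1)) := by
  induction m with
  | zero => simp
  | succ m ih =>
    have h : HasSum (fun k : ℕ => 1 / ((k : ℝ) + 1 + m) - 1 / ((k : ℝ) + 1 + (m + 1 : ℕ)))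
        (1 / ((m : ℝ) + 1)) := by
      rw [hasSum_iff_tendsto_nat_of_nonneg]
      · have h1 : ∀ n : ℕ, ∑ k ∈ Finset.range n,
            (1 / ((k : ℝ) + 1 + m) - 1 / ((k : ℝ) + 1 + (m + 1 : ℕ)))
            = 1 / ((m : ℝ) + 1) - 1 / (((n + m : ℕ) : ℝ) + 1) := by
          intro n
          have := Finset.sum_range_sub' (fun k : ℕ => 1 / ((k : ℝ) + 1 + m)) n
          push_cast at this ⊢
          convert this using 3 <;> ring_nf
        simp only [h1]
        have h2 := (tendsto_one_div_add_atTop_nhds_zero_nat (𝕜 := ℝ)).comp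
          (Filter.tendsto_add_atTop_nat m)
        simpa using h2.const_sub (1 / ((m : ℝ) + 1))
      · intro k
        rw [sub_nonneg]
        refine one_div_le_one_div_of_le (by positivity) ?_
        push_cast
        linarith
    rw [Finset.sum_range_succ]
    convert ih.add h using 2 with k
    ring

/-- The sum formula in weight five. -/
theorem doubleZeta_sum_five :
    doubleZeta 4 1 + doubleZeta 3 2 + doubleZeta 2 3 = zetaReal 5 := by
  -- With n = m + k, the sum of 1/(n k m³) is computed twice: here 1/(kn) = (1/k - 1/n)/m telescopes
  -- over k to give H_m/m⁴; below, partial fractions give double zetas.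
  have h1 : HasSum (fun p : ℕ × ℕ =>
      1 / (((p.1 : ℝ) + p.2 + 2) * ((p.2 : ℝ) + 1) * ((p.1 : ℝ) + 1) ^ 3))
      (doubleZeta 4 1 + zetaReal 5) := by
    refine hasSum_prod_of_nonneg (fun p => by positivity) (fun m => ?_)
      (hasSum_genHarmonic_div le_rfl (show 2 ≤ 4 by norm_num) (by norm_num))
    have h := (hasSum_one_div_sub_one_div (m + 1)).div_const (((m : ℝ) + 1) ^ 4)
    have hH : genHarmonic 1 (m + 1) = ∑ j ∈ Finset.range (m + 1), 1 / ((j : ℝ) + 1) := by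
      simp only [genHarmonic_succ, pow_one]
    rw [hH]
    refine hasSum_of_forall_eq h fun k => ?_
    have h1 : (m : ℝ) + k + 2 ≠ 0 := by positivity
    have h2 : (k : ℝ) + 1 + ((m + 1 : ℕ) : ℝ) = m + k + 2 := by push_cast; ring
    simp only [h2]
    field_simp
    ring
  have h2 := ((hasSum_doubleZeta (show 2 ≤ 4 by norm_num) le_rfl (by norm_num)).add
    (hasSum_doubleZeta (show 2 ≤ 3 by norm_num) (show 1 ≤ 2 by norm_num) (by norm_num))).add
    (hasSum_doubleZeta (show 2 ≤ 2 by norm_num) (show 1 ≤ 3 by norm_num) (by norm_num))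
  have h3 := h2.add (hasSum_doubleZeta_swap (show 2 ≤ 4 by norm_num) le_rfl (by norm_num))
  have h4 := h1.unique (by
    convert h3 using 2 with p
    have : (p.1 : ℝ) + p.2 + 2 ≠ 0 := by positivity
    field_simp
    ring)
  linarith

/-- The shuffle product `ζ(2)ζ(3)`. -/
theorem zetaReal_two_mul_three_shuffle :
    zetaReal 2 * zetaReal 3 = 6 * doubleZeta 4 1 + 3 * doubleZeta 3 2 + doubleZeta 2 3 := by
  have h41 := hasSum_doubleZeta (show 2 ≤ 4 by norm_num) (show 1 ≤ 1 by norm_num) (by norm_num)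
  have h32 := hasSum_doubleZeta (show 2 ≤ 3 by norm_num) (show 1 ≤ 2 by norm_num) (by norm_num)
  have g41 := hasSum_doubleZeta_swap (show 2 ≤ 4 by norm_num) (show 1 ≤ 1 by norm_num) (by norm_num)
  have g32 := hasSum_doubleZeta_swap (show 2 ≤ 3 by norm_num) (show 1 ≤ 2 by norm_num) (by norm_num)
  have g23 := hasSum_doubleZeta_swap (show 2 ≤ 2 by norm_num) (show 1 ≤ 3 by norm_num) (by norm_num)
  -- The coefficients come from iterating 1/(mk) = (1/m + 1/k)/(m + k); the `h` terms keep powers of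
  -- m, the `g` terms powers of k.
  refine ((hasSum_zetaReal_mul (show 2 ≤ 2 by norm_num) (show 2 ≤ 3 by norm_num)).unique
    (hasSum_of_forall_eq
      (((h41.mul_left 3).add (h32.mul_left 1)).add
        (((g41.mul_left 3).add (g32.mul_left 2)).add (g23.mul_left 1))) fun p => ?_)).trans ?_
  rotate_left
  · ring
  · have hp : (p.1 : ℝ) + p.2 + 2 = (p.1 + 1) + (p.2 + 1) := by ring
    have hm : 0 < (p.1 : ℝ) + 1 := by positivity
    have hk : 0 < (p.2 : ℝ) + 1 := by positivity
    rw [hp]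
    generalize (p.1 : ℝ) + 1 = m at *
    generalize (p.2 : ℝ) + 1 = k at *
    field_simp
    ring

/-- The shuffle product `ζ(3)²`. -/
theorem zetaReal_three_sq_shuffle :
    zetaReal 3 * zetaReal 3 = 12 * doubleZeta 5 1 + 6 * doubleZeta 4 2 + 2 * doubleZeta 3 3 := by
  have h51 := hasSum_doubleZeta (show 2 ≤ 5 by norm_num) (show 1 ≤ 1 by norm_num) (by norm_num)
  have h42 := hasSum_doubleZeta (show 2 ≤ 4 by norm_num) (show 1 ≤ 2 by norm_num) (by norm_num)
  have h33 := hasSum_doubleZeta (show 2 ≤ 3 by norm_num) (show 1 ≤ 3 by norm_num) (by norm_num)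
  have g51 := hasSum_doubleZeta_swap (show 2 ≤ 5 by norm_num) (show 1 ≤ 1 by norm_num) (by norm_num)
  have g42 := hasSum_doubleZeta_swap (show 2 ≤ 4 by norm_num) (show 1 ≤ 2 by norm_num) (by norm_num)
  have g33 := hasSum_doubleZeta_swap (show 2 ≤ 3 by norm_num) (show 1 ≤ 3 by norm_num) (by norm_num)
  refine ((hasSum_zetaReal_mul (show 2 ≤ 3 by norm_num) (show 2 ≤ 3 by norm_num)).unique
    (hasSum_of_forall_eq
      ((((h51.mul_left 6).add (h42.mul_left 3)).add (h33.mul_left 1)).add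
        (((g51.mul_left 6).add (g42.mul_left 3)).add (g33.mul_left 1))) fun p => ?_)).trans ?_
  rotate_left
  · ring
  · have hp : (p.1 : ℝ) + p.2 + 2 = (p.1 + 1) + (p.2 + 1) := by ring
    have hm : 0 < (p.1 : ℝ) + 1 := by positivity
    have hk : 0 < (p.2 : ℝ) + 1 := by positivity
    rw [hp]
    generalize (p.1 : ℝ) + 1 = m at *
    generalize (p.2 : ℝ) + 1 = k at *
    field_simp
    ring

/-- The shuffle product `ζ(2)ζ(4)`. -/
theorem zetaReal_two_mul_four_shuffle :
    zetaReal 2 * zetaReal 4 =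
      8 * doubleZeta 5 1 + 4 * doubleZeta 4 2 + 2 * doubleZeta 3 3 + doubleZeta 2 4 := by
  have h51 := hasSum_doubleZeta (show 2 ≤ 5 by norm_num) (show 1 ≤ 1 by norm_num) (by norm_num)
  have h42 := hasSum_doubleZeta (show 2 ≤ 4 by norm_num) (show 1 ≤ 2 by norm_num) (by norm_num)
  have g51 := hasSum_doubleZeta_swap (show 2 ≤ 5 by norm_num) (show 1 ≤ 1 by norm_num) (by norm_num)
  have g42 := hasSum_doubleZeta_swap (show 2 ≤ 4 by norm_num) (show 1 ≤ 2 by norm_num) (by norm_num)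
  have g33 := hasSum_doubleZeta_swap (show 2 ≤ 3 by norm_num) (show 1 ≤ 3 by norm_num) (by norm_num)
  have g24 := hasSum_doubleZeta_swap (show 2 ≤ 2 by norm_num) (show 1 ≤ 4 by norm_num) (by norm_num)
  refine ((hasSum_zetaReal_mul (show 2 ≤ 2 by norm_num) (show 2 ≤ 4 by norm_num)).unique
    (hasSum_of_forall_eq
      (((h51.mul_left 4).add (h42.mul_left 1)).add
        ((((g51.mul_left 4).add (g42.mul_left 3)).add (g33.mul_left 2)).add (g24.mul_left 1))) fun p => ?_)).trans ?_
  rotate_left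
  · ring
  · have hp : (p.1 : ℝ) + p.2 + 2 = (p.1 + 1) + (p.2 + 1) := by ring
    have hm : 0 < (p.1 : ℝ) + 1 := by positivity
    have hk : 0 < (p.2 : ℝ) + 1 := by positivity
    rw [hp]
    generalize (p.1 : ℝ) + 1 = m at *
    generalize (p.2 : ℝ) + 1 = k at *
    field_simp
    ring

/-! ### Averaged binomial transforms -/

theorem hasSum_choose_div_two_pow (k : ℕ) :
    HasSum (fun n : ℕ => 1 / 2 ^ (n + 1) * (n.choose k : ℝ)) 1 := by
  -- This is ∑ C(n,k) xⁿ = x^k/(1-x)^(k+1) at x = 1/2.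
  have h := (hasSum_choose_mul_geometric_of_norm_lt_one (𝕜 := ℝ) k
    (r := 1 / 2) (by norm_num)).mul_left (1 / 2 ^ (k + 1))
  rw [← hasSum_nat_add_iff' k]
  rw [Finset.sum_eq_zero fun i hi => by
    rw [Nat.choose_eq_zero_of_lt (Finset.mem_range.1 hi), Nat.cast_zero, mul_zero], sub_zero]
  convert! h using 1
  · funext n
    rw [one_div_pow]
    field_simp
    ring
  · rw [show (1 : ℝ) - 1 / 2 = 1 / 2 by norm_num, one_div_mul_one_div, ← mul_pow]
    norm_num

/-- Averaging binomial transforms with weights `2^{-(n+1)}` preserves the sum. -/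
theorem hasSum_binomial_transform {a : ℕ → ℝ} (ha : ∀ k, 0 ≤ a k) {S : ℝ}
    (hS : HasSum (fun k => a (k + 1)) S) :
    HasSum (fun n : ℕ => 1 / 2 ^ (n + 1) * ∑ k ∈ Finset.Icc 1 n, (n.choose k : ℝ) * a k) S := by
  refine hasSum_comm_of_nonneg
    (f := fun k n => 1 / 2 ^ (n + 1) * (n.choose (k + 1) : ℝ) * a (k + 1))
    (fun k n => mul_nonneg (by positivity) (ha _))
    (fun k => by simpa using (hasSum_choose_div_two_pow (k + 1)).mul_right (a (k + 1))) hS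
    (fun n => ?_)
  have h := hasSum_sum_of_ne_finset_zero (L := SummationFilter.unconditional ℕ)
    (s := Finset.range n)
    (f := fun k => 1 / 2 ^ (n + 1) * (n.choose (k + 1) : ℝ) * a (k + 1)) fun k hk => by
      rw [Nat.choose_eq_zero_of_lt (by simpa [Nat.lt_succ_iff] using hk)]
      simp
  convert h using 1
  rw [Finset.mul_sum, Finset.range_eq_Ico, ← Finset.Ico_add_one_right_eq_Icc,
    Finset.sum_Ico_add' (fun k => 1 / 2 ^ (n + 1) * (n.choose k : ℝ) * a k) 0 n 1]
  exact Finset.sum_congr (by simp) fun k _ => (mul_assoc _ _ _).symm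

theorem hasSum_binomHarmonicTerm {q : ℕ} (hq : 2 ≤ q) :
    HasSum (binomHarmonicTerm q) (doubleZeta q 2 + zetaReal (q + 2)) := by
  refine hasSum_binomial_transform (a := fun k => genHarmonic 2 k / (k : ℝ) ^ q)
    (fun k => div_nonneg (Finset.sum_nonneg fun _ _ => by positivity) (by positivity)) ?_
  simpa using hasSum_genHarmonic_div (r := 2) (by norm_num) hq (by omega)

/-! ### Even zeta values and the final elimination -/

theorem bernoulli_six : bernoulli 6 = 1 / 42 := by
  rw [bernoulli_eq_bernoulli'_of_ne_one (by norm_num), bernoulli'_def]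
  have h5 : bernoulli' 5 = 0 := bernoulli'_eq_zero_of_odd (by decide) (by norm_num)
  have c2 : Nat.choose 6 2 = 15 := by decide
  have c4 : Nat.choose 6 4 = 15 := by decide
  norm_num [Finset.sum_range_succ, h5, c2, c4]

theorem riemannZeta_six : riemannZeta 6 = (Real.pi : ℂ) ^ 6 / 945 := by
  have h := riemannZeta_two_mul_nat (k := 3) (by norm_num)
  norm_num [bernoulli_six, Nat.factorial] at h
  rw [h]
  ring

theorem theorem4p13 :
    HasSum (fun n : ℕ => (binomHarmonicTerm 4 n : ℂ))
      (riemannZeta 2 * riemannZeta 4 + riemannZeta 3 ^ 2 - 25 / 12 * riemannZeta 6) ∧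
    HasSum (fun n : ℕ => (binomHarmonicTerm 2 n : ℂ))
      (riemannZeta 2 ^ 2 - 3 / 4 * riemannZeta 4) ∧
    HasSum (fun n : ℕ => (binomHarmonicTerm 3 n : ℂ))
      (3 * riemannZeta 2 * riemannZeta 3 - 9 / 2 * riemannZeta 5) := by
  have z2 : riemannZeta 2 = (zetaReal 2 : ℂ) := by
    exact_mod_cast riemannZeta_eq_zetaReal (s := 2) le_rfl
  have z3 : riemannZeta 3 = (zetaReal 3 : ℂ) := by
    exact_mod_cast riemannZeta_eq_zetaReal (s := 3) (by norm_num)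
  have z4 : riemannZeta 4 = (zetaReal 4 : ℂ) := by
    exact_mod_cast riemannZeta_eq_zetaReal (s := 4) (by norm_num)
  have z5 : riemannZeta 5 = (zetaReal 5 : ℂ) := by
    exact_mod_cast riemannZeta_eq_zetaReal (s := 5) (by norm_num)
  have z6 : riemannZeta 6 = (zetaReal 6 : ℂ) := by
    exact_mod_cast riemannZeta_eq_zetaReal (s := 6) (by norm_num)
  have e4 : zetaReal 2 * zetaReal 2 = 5 / 2 * zetaReal 4 := by
    have h : riemannZeta 2 * riemannZeta 2 = 5 / 2 * riemannZeta 4 := by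
      rw [riemannZeta_two, riemannZeta_four]
      ring
    rw [z2, z4] at h
    exact Complex.ofReal_injective (by push_cast; exact h)
  have e6 : zetaReal 2 * zetaReal 4 = 7 / 4 * zetaReal 6 := by
    have h : riemannZeta 2 * riemannZeta 4 = 7 / 4 * riemannZeta 6 := by
      rw [riemannZeta_two, riemannZeta_four, riemannZeta_six]
      ring
    rw [z2, z4, z6] at h
    exact Complex.ofReal_injective (by push_cast; exact h)
  have s22 := zetaReal_mul_zetaReal (a := 2) (b := 2) le_rfl le_rfl
  have s23 := zetaReal_mul_zetaReal (a := 2) (b := 3) le_rfl (by norm_num)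
  have s24 := zetaReal_mul_zetaReal (a := 2) (b := 4) le_rfl (by norm_num)
  have s33 := zetaReal_mul_zetaReal (a := 3) (b := 3) (by norm_num) (by norm_num)
  norm_num at s22 s23 s24 s33
  have t23 := zetaReal_two_mul_three_shuffle
  have t33 := zetaReal_three_sq_shuffle
  have t24 := zetaReal_two_mul_four_shuffle
  have t5 := doubleZeta_sum_five
  rw [z2, z3, z4, z5, z6]
  refine ⟨?_, ?_, ?_⟩
  · have h : doubleZeta 4 2 + zetaReal 6 =
        zetaReal 2 * zetaReal 4 + zetaReal 3 ^ 2 - 25 / 12 * zetaReal 6 := by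
      rw [sq]
      -- The combination `t24` - (2/3) `t33` cancels ζ(5,1) and ζ(4,2); `s33` and `s24` then replace
      -- ζ(3,3) and ζ(2,4), leaving ζ(4,2) = ζ(3)² - (4/3) ζ(6).
      linarith
    have hs := Complex.hasSum_ofReal.2 (hasSum_binomHarmonicTerm (q := 4) (by norm_num))
    rw [show 4 + 2 = 6 from rfl, h] at hs
    simpa using hs
  · have h : doubleZeta 2 2 + zetaReal 4 = zetaReal 2 ^ 2 - 3 / 4 * zetaReal 4 := by
      rw [sq]
      linarith
    have hs := Complex.hasSum_ofReal.2 (hasSum_binomHarmonicTerm (q := 2) le_rfl)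
    rw [show 2 + 2 = 4 from rfl, h] at hs
    simpa using hs
  · have h : doubleZeta 3 2 + zetaReal 5 =
        3 * zetaReal 2 * zetaReal 3 - 9 / 2 * zetaReal 5 := by
      rw [mul_assoc]
      linarith
    have hs := Complex.hasSum_ofReal.2 (hasSum_binomHarmonicTerm (q := 3) (by norm_num))
    rw [show 3 + 2 = 5 from rfl, h] at hs
    simpa using hs
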